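/- Let $k$ be a field and let $H$ be a Hopf algebra over $k$. A right integral on $H$ is a linear functional $\chi: H\to k$ with $\sum \chi(a_{(1)})\,a_{(2)}=\chi(a)1$ for all $a\in H$. Let $H^*=\mathrm{Hom}_k(H,k)$ be the dual algebra, with the convolution product $(\xi*\eta)(h)=\sum\xi(h_{(1)})\eta(h_{(2)})$. Let $\mathsf{Comod}\text{-}H$ be the category of right $H$-comodules, with $\mathrm{Hom}^H$ denoting the sets of comodule morphisms, and let $H^*\text{-}\mathsf{Mod}$ be the category of left $H^*$-modules. Let $$T:\mathsf{Comod}\text{-}H\longrightarrow H^*\text{-}\mathsf{Mod},\qquad T(X)=\mathrm{Hom}^H(H,X),$$ where $H$ is a right comodule over itself via its comultiplication, $H^*$ acts by $(\xi*f)(h)=\sum\xi(h_{(1)})f(h_{(2)})$, and $T$ sends a morphism $g$ to $f\mapsto g\circ f$. If $H$ has a non-zero right integral, then there exists a functor $U:H^*\text{-}\mathsf{Mod}\longrightarrow\mathsf{Comod}\text{-}H$ which is a left adjoint of $T$ and which is exact, i.e. preserves finite limits and finite colimits. -/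

import Mathlib

open CategoryTheory TensorProduct

universe u v

/-- A right comodule over the `k`-coalgebra `H`: a `k`-vector space `M` with a `k`-linear
coaction `ρ : M → M ⊗ H` that is coassociative and counital. -/
structure Comod (k : Type u) (H : Type v) [Field k] [AddCommGroup H] [Module k H]
    [Coalgebra k H] where
  /-- the underlying vector space -/
  carrier : Type v
  [addCommGroup : AddCommGroup carrier]
  [module : Module k carrier]
  /-- the coaction -/
  coact : carrier →ₗ[k] carrier ⊗[k] H
  coassoc : (TensorProduct.assoc k carrier H H).toLinearMap ∘ₗ coact.rTensor H ∘ₗ coact =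
    (Coalgebra.comul (R := k) (A := H)).lTensor carrier ∘ₗ coact
  lTensor_counit_comp_coact : (Coalgebra.counit (R := k) (A := H)).lTensor carrier ∘ₗ coact =
    (TensorProduct.mk k carrier k).flip 1

attribute [instance] Comod.addCommGroup Comod.module

namespace Comod

section Coalg

variable {k : Type u} {H : Type v} [Field k] [AddCommGroup H] [Module k H] [Coalgebra k H]

/-- `Hom^H(M, N)`: the linear maps `f : M → N` with `ρ_N ∘ f = (f ⊗ id) ∘ ρ_M`. -/
def colinear (M N : Comod k H) : Submodule k (M.carrier →ₗ[k] N.carrier) where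
  carrier := {f | N.coact ∘ₗ f = f.rTensor H ∘ₗ M.coact}
  add_mem' {f g} hf hg := by
    simp only [Set.mem_ofPred_eq] at hf hg ⊢
    rw [LinearMap.comp_add, LinearMap.rTensor_add, LinearMap.add_comp, hf, hg]
  zero_mem' := by simp
  smul_mem' c f hf := by
    simp only [Set.mem_ofPred_eq] at hf ⊢
    rw [LinearMap.comp_smul, LinearMap.rTensor_smul, LinearMap.smul_comp, hf]

theorem mem_colinear {M N : Comod k H} {f : M.carrier →ₗ[k] N.carrier} :
    f ∈ colinear M N ↔ N.coact ∘ₗ f = f.rTensor H ∘ₗ M.coact := Iff.rfl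

theorem id_mem_colinear (M : Comod k H) : LinearMap.id ∈ colinear M M := by
  simp [mem_colinear]

theorem comp_mem_colinear {L M N : Comod k H} {f : L.carrier →ₗ[k] M.carrier}
    {g : M.carrier →ₗ[k] N.carrier} (hf : f ∈ colinear L M) (hg : g ∈ colinear M N) :
    g ∘ₗ f ∈ colinear L N := by
  rw [mem_colinear] at *
  rw [← LinearMap.comp_assoc, hg, LinearMap.comp_assoc, hf, LinearMap.rTensor_comp,
    LinearMap.comp_assoc]

/-- The category of right `H`-comodules, with the colinear maps as morphisms. -/
instance : Category (Comod k H) where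
  Hom M N := colinear M N
  id M := ⟨LinearMap.id, id_mem_colinear M⟩
  comp f g := ⟨g.1 ∘ₗ f.1, comp_mem_colinear f.2 g.2⟩

variable (k H) in
/-- `H` as a right comodule over itself, through its comultiplication. -/
abbrev regular : Comod k H where
  carrier := H
  coact := Coalgebra.comul
  coassoc := Coalgebra.coassoc
  lTensor_counit_comp_coact := Coalgebra.lTensor_counit_comp_comul

/-- For `ξ ∈ H^*` and a linear map `f : H → X`, the map `ξ * f : h ↦ ∑ ξ(h₁) f(h₂)`. -/
noncomputable def convAct {X : Type v} [AddCommGroup X] [Module k X] (ξ : H →ₗ[k] k) (f : H →ₗ[k] X) :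
    H →ₗ[k] X :=
  (TensorProduct.lid k X).toLinearMap ∘ₗ TensorProduct.map ξ f ∘ₗ Coalgebra.comul

theorem convAct_mem_colinear {X : Comod k H} (ξ : H →ₗ[k] k)
    {f : H →ₗ[k] X.carrier} (hf : f ∈ colinear (regular k H) X) :
    convAct ξ f ∈ colinear (regular k H) X := by
  have h1 : X.coact ∘ₗ (TensorProduct.lid k X.carrier).toLinearMap ∘ₗ TensorProduct.map ξ f =
      (TensorProduct.lid k _).toLinearMap ∘ₗ TensorProduct.map ξ (X.coact ∘ₗ f) := by
    ext; simp
  have h2 : (TensorProduct.lid k _).toLinearMap ∘ₗ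
      TensorProduct.map ξ (f.rTensor H ∘ₗ Coalgebra.comul) =
      ((TensorProduct.lid k X.carrier).toLinearMap ∘ₗ TensorProduct.map ξ f).rTensor H ∘ₗ
        (TensorProduct.assoc k H H H).symm.toLinearMap ∘ₗ
        (Coalgebra.comul (R := k) (A := H)).lTensor H := by
    have : ∀ φ : H →ₗ[k] H ⊗[k] H, (TensorProduct.lid k _).toLinearMap ∘ₗ
      TensorProduct.map ξ (f.rTensor H ∘ₗ φ) =
      (((TensorProduct.lid k X.carrier).toLinearMap ∘ₗ TensorProduct.map ξ f).rTensor H ∘ₗ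
        (TensorProduct.assoc k H H H).symm.toLinearMap) ∘ₗ φ.lTensor H := by
      intro φ
      have e : TensorProduct.map ξ (f.rTensor H ∘ₗ φ) =
        TensorProduct.map ξ (f.rTensor H) ∘ₗ φ.lTensor H := by ext; simp
      rw [e, ← LinearMap.comp_assoc]
      congr 1
      ext; simp [TensorProduct.smul_tmul']
    exact this _
  change X.coact ∘ₗ f = f.rTensor H ∘ₗ Coalgebra.comul at hf
  change X.coact ∘ₗ ((TensorProduct.lid k X.carrier).toLinearMap ∘ₗ TensorProduct.map ξ f ∘ₗ
      Coalgebra.comul) = ((TensorProduct.lid k X.carrier).toLinearMap ∘ₗ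
      TensorProduct.map ξ f ∘ₗ Coalgebra.comul).rTensor H ∘ₗ Coalgebra.comul
  have h3 := congrArg (fun φ => φ ∘ₗ Coalgebra.comul (R := k) (A := H)) h1
  have h4 := congrArg (fun φ => φ ∘ₗ Coalgebra.comul (R := k) (A := H)) h2
  simp only [hf, LinearMap.comp_assoc, Coalgebra.coassoc_symm, LinearMap.rTensor_comp] at h3 h4 ⊢
  rw [h3, h4]

theorem convAct_convMul {X : Type v} [AddCommGroup X] [Module k X]
    (ξ η : WithConv (H →ₗ[k] k)) (f : H →ₗ[k] X) :
    convAct (ξ * η).ofConv f = convAct ξ.ofConv (convAct η.ofConv f) := by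
  have key : ∀ φ ψ : H →ₗ[k] H ⊗[k] H,
      (TensorProduct.assoc k H H H).toLinearMap ∘ₗ φ.rTensor H ∘ₗ φ = ψ.lTensor H ∘ₗ ψ →
      (TensorProduct.lid k X).toLinearMap ∘ₗ TensorProduct.map
        (LinearMap.mul' k k ∘ₗ TensorProduct.map ξ.ofConv η.ofConv ∘ₗ φ) f ∘ₗ φ =
      (TensorProduct.lid k X).toLinearMap ∘ₗ TensorProduct.map ξ.ofConv
        ((TensorProduct.lid k X).toLinearMap ∘ₗ TensorProduct.map η.ofConv f ∘ₗ ψ) ∘ₗ ψ := by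
    intro φ ψ h
    have e2 : TensorProduct.map ξ.ofConv
        ((TensorProduct.lid k X).toLinearMap ∘ₗ TensorProduct.map η.ofConv f ∘ₗ ψ) =
        TensorProduct.map ξ.ofConv ((TensorProduct.lid k X).toLinearMap ∘ₗ
          TensorProduct.map η.ofConv f) ∘ₗ ψ.lTensor H := by ext; simp
    have e1 : (TensorProduct.lid k X).toLinearMap ∘ₗ TensorProduct.map
        (LinearMap.mul' k k ∘ₗ TensorProduct.map ξ.ofConv η.ofConv ∘ₗ φ) f =
        ((TensorProduct.lid k X).toLinearMap ∘ₗ TensorProduct.map ξ.ofConv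
          ((TensorProduct.lid k X).toLinearMap ∘ₗ TensorProduct.map η.ofConv f)) ∘ₗ
        (TensorProduct.assoc k H H H).toLinearMap ∘ₗ φ.rTensor H := by
      have a : TensorProduct.map
        (LinearMap.mul' k k ∘ₗ TensorProduct.map ξ.ofConv η.ofConv ∘ₗ φ) f =
        TensorProduct.map
        (LinearMap.mul' k k ∘ₗ TensorProduct.map ξ.ofConv η.ofConv) f ∘ₗ φ.rTensor H := by
        ext; simp
      rw [a, ← LinearMap.comp_assoc, ← LinearMap.comp_assoc]
      congr 1
      ext a b c; simp [smul_smul, mul_comm]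
    rw [e2, ← LinearMap.comp_assoc, e1]
    simp only [LinearMap.comp_assoc]
    rw [h]
  exact key _ _ Coalgebra.coassoc

theorem convAct_one {X : Type v} [AddCommGroup X] [Module k X] (f : H →ₗ[k] X) :
    convAct (1 : WithConv (H →ₗ[k] k)).ofConv f = f := by
  have e : TensorProduct.map (1 : WithConv (H →ₗ[k] k)).ofConv f =
      f.lTensor k ∘ₗ (Coalgebra.counit (R := k) (A := H)).rTensor H := by
    ext; simp [LinearMap.convOne_def]
  rw [convAct, e, LinearMap.comp_assoc, Coalgebra.rTensor_counit_comp_comul]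
  ext; simp

/-- The left `H^*`-module structure on `Hom^H(H, X)`, `(ξ * f)(h) = ∑ ξ(h₁) f(h₂)`, where
`H^* = WithConv (H →ₗ[k] k)` is the dual algebra with the convolution product
`(ξ * η)(h) = ∑ ξ(h₁) η(h₂)` and unit the counit of `H`. -/
noncomputable instance (X : Comod k H) : Module (WithConv (H →ₗ[k] k)) (colinear (regular k H) X) where
  smul ξ f := ⟨convAct (H := H) ξ.ofConv f.1, convAct_mem_colinear ξ.ofConv f.2⟩
  one_smul f := Subtype.ext (convAct_one f.1)
  mul_smul ξ η f := Subtype.ext (convAct_convMul ξ η f.1)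
  smul_zero ξ := Subtype.ext (by
    change convAct (H := H) ξ.ofConv 0 = 0
    simp [convAct])
  smul_add ξ f g := Subtype.ext (by
    change convAct (H := H) ξ.ofConv (f.1 + g.1) = convAct (H := H) ξ.ofConv f.1 + convAct (H := H) ξ.ofConv g.1
    simp [convAct, TensorProduct.map_add_right, LinearMap.add_comp, LinearMap.comp_add])
  add_smul ξ η f := Subtype.ext (by
    change convAct (H := H) (ξ + η).ofConv f.1 = convAct (H := H) ξ.ofConv f.1 + convAct (H := H) η.ofConv f.1
    simp [convAct, TensorProduct.map_add_left, LinearMap.add_comp, LinearMap.comp_add])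
  zero_smul f := Subtype.ext (by
    change convAct (H := H) (0 : WithConv (H →ₗ[k] k)).ofConv f.1 = 0
    simp [convAct])

theorem convAct_comp {X Y : Type v} [AddCommGroup X] [Module k X] [AddCommGroup Y] [Module k Y]
    (ξ : H →ₗ[k] k) (f : H →ₗ[k] X) (g : X →ₗ[k] Y) :
    g ∘ₗ convAct ξ f = convAct ξ (g ∘ₗ f) := by
  have e : g ∘ₗ (TensorProduct.lid k X).toLinearMap ∘ₗ TensorProduct.map ξ f =
      (TensorProduct.lid k Y).toLinearMap ∘ₗ TensorProduct.map ξ (g ∘ₗ f) := by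
    ext; simp
  have e' := congrArg (fun φ => φ ∘ₗ Coalgebra.comul (R := k) (A := H)) e
  simpa only [convAct, LinearMap.comp_assoc] using e'

variable (k H) in
/-- The functor `T = Hom^H(H, -)` from right `H`-comodules to left `H^*`-modules; a morphism
`g` of comodules is sent to `f ↦ g ∘ f`. -/
noncomputable def homFunctor : Comod k H ⥤ ModuleCat.{v} (WithConv (H →ₗ[k] k)) where
  obj X := ModuleCat.of _ (colinear (regular k H) X)
  map {X Y} g := ModuleCat.ofHom
    { toFun := fun f => ⟨g.1 ∘ₗ f.1, comp_mem_colinear f.2 g.2⟩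
      map_add' := fun f f' => Subtype.ext (LinearMap.comp_add _ _ _)
      map_smul' := fun ξ f => Subtype.ext (convAct_comp (H := H) ξ.ofConv f.1 g.1) }

end Coalg

end Comod

/-- A right integral on the Hopf algebra `H`: a linear functional `χ` on `H` with
`∑ χ(a₁) a₂ = χ(a) 1` for all `a`. -/
def IsRightIntegral {k : Type u} {H : Type v} [Field k] [Ring H] [HopfAlgebra k H]
    (χ : H →ₗ[k] k) : Prop :=
  ∀ a : H, TensorProduct.lid k H (χ.rTensor H (Coalgebra.comul (R := k) a)) = χ a • (1 : H)

/-!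
For a left `H^*`-module `M`, let `H^*` act on `H` from the right by `h · ξ = ∑ ξ(h₁) h₂`. The
coaction `h ⊗ m ↦ (h₁ ⊗ m) ⊗ h₂` makes `H ⊗_{H^*} M` a right `H`-comodule, and the usual
tensor-hom correspondence makes `H ⊗_{H^*} -` left adjoint to `Hom^H(H, -)`, for any coalgebra `H`
(`Comod.tensorHomAdjunction`). A left adjoint preserves colimits, so what the integral has to supply
is left exactness, that is, flatness of `H` as a right `H^*`-module.

Let `χ` be a non-zero right integral, and put `α(h) = χ(S(h) -)`, an element of `H^*`. The integral
property gives `∑ χ(S(h) x₁) x₂ = ∑ h₁ χ(S(h₂) x)` (`HopfAlgebra.antipodeForm_comul`), which has two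
consequences.

* `α : H → H^*` is right `H^*`-linear, so `h ⊗ m ↦ α(h) m` is a well defined natural map
  `H ⊗_{H^*} M → M` (`Comod.DualTensor.toModule`).
* `ker α` is a left coideal. It is also a left ideal, as `S` is anti-multiplicative. So if
  `c ∈ ker α` then `ε(c) 1 = ∑ S(c₁) c₂ ∈ ker α`, and since `α(1) = χ ≠ 0` this forces `ε(c) = 0`
  (`HopfAlgebra.counit_eq_zero_of_antipodeForm_eq_zero`). By duality for finite-dimensional spaces,
  `ε` agrees with some `χ(S(-) e)` on any given finite-dimensional subspace, and therefore every
  finite subset of `H` admits an `e` with `h = e · α(h)` for all `h` in it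
  (`HopfAlgebra.exists_forall_mem_antipodeForm_comul_eq`).

Hence `∑ hᵢ ⊗ mᵢ = ∑ e · α(hᵢ) ⊗ mᵢ = e ⊗ ∑ α(hᵢ) mᵢ` for a suitable `e`: every `t ∈ H ⊗_{H^*} M` is
`e ⊗ m`, where `m` is the image of `t` in `M` (`Comod.DualTensor.exists_eq_mk_toModule`). So
`H ⊗_{H^*} M → M` is injective, and `H ⊗_{H^*} -` preserves kernels.
-/

/-! ### The form attached to a right integral -/

namespace HopfAlgebra

variable {k : Type u} {H : Type v} [Field k] [Ring H] [HopfAlgebra k H]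

open Coalgebra WithConv

/-- `∑ (S(h₁) ⊗ 1) Δ(h₂) = 1 ⊗ h`. -/
theorem mul_antipode_tmul_one_comul (h : H) :
    LinearMap.mul' k (H ⊗[k] H) (TensorProduct.map
      ((TensorProduct.mk k H H).flip 1 ∘ₗ antipode k) comul (comul h)) = (1 : H) ⊗ₜ[k] h := by
  have e : LinearMap.mul' k (H ⊗[k] H) ∘ₗ TensorProduct.map
      ((TensorProduct.mk k H H).flip 1 ∘ₗ antipode k) comul =
      (LinearMap.mul' k H ∘ₗ (antipode k).rTensor H).rTensor H ∘ₗ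
        (TensorProduct.assoc k H H H).symm.toLinearMap ∘ₗ comul.lTensor H := by
    ext a b
    suffices ∀ t : H ⊗[k] H, (antipode k a ⊗ₜ[k] (1 : H)) * t =
        (LinearMap.mul' k H ∘ₗ (antipode k).rTensor H).rTensor H
          ((TensorProduct.assoc k H H H).symm (a ⊗ₜ t)) by simpa using this (comul b)
    intro t
    induction t with
    | zero => simp
    | add x y hx hy => simp [mul_add, tmul_add, hx, hy]
    | tmul x y => simp
  have e' := congrArg (fun φ => φ (comul h)) e
  simp only [LinearMap.comp_apply, LinearEquiv.coe_coe, coassoc_symm_apply] at e'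
  refine e'.trans ?_
  rw [← LinearMap.comp_apply, ← LinearMap.rTensor_comp, LinearMap.comp_assoc,
    HopfAlgebra.mul_antipode_rTensor_comul, LinearMap.rTensor_comp, LinearMap.comp_apply,
    rTensor_counit_comul]
  simp

/-- The antipode reverses the comultiplication: `Δ(S(h)) = ∑ S(h₂) ⊗ S(h₁)`. -/
theorem comul_antipode (h : H) :
    comul (R := k) (antipode k h) =
      TensorProduct.map (antipode k) (antipode k) (TensorProduct.comm k H H (comul h)) := by
  let G : H →ₗ[k] H ⊗[k] H := TensorProduct.map (antipode k) (antipode k) ∘ₗ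
        (TensorProduct.comm k H H).toLinearMap ∘ₗ comul
  suffices toConv G = toConv (comul ∘ₗ antipode k) from
    (LinearMap.congr_fun (WithConv.toConv_injective this) h).symm
  -- both sides invert `Δ` in the convolution algebra `Hom(H, H ⊗ H)`
  refine left_inv_eq_right_inv (a := toConv (comul (R := k) (A := H))) ?_
    LinearMap.comul_right_inv
  let A : H ⊗[k] H →ₗ[k] H ⊗[k] H := LinearMap.mul' k (H ⊗[k] H) ∘ₗ TensorProduct.map
      ((TensorProduct.mk k H H).flip 1 ∘ₗ antipode k) comul
  have hA : A ∘ₗ comul = TensorProduct.mk k H H 1 :=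
    LinearMap.ext mul_antipode_tmul_one_comul
  let Ψ : H ⊗[k] (H ⊗[k] H) →ₗ[k] H ⊗[k] H :=
    LinearMap.mul' k (H ⊗[k] H) ∘ₗ (TensorProduct.mk k H H 1 ∘ₗ antipode k).rTensor _
  have e : LinearMap.mul' k (H ⊗[k] H) ∘ₗ TensorProduct.map G comul =
      Ψ ∘ₗ A.lTensor H ∘ₗ (TensorProduct.assoc k H H H).toLinearMap ∘ₗ comul.rTensor H := by
    ext a b
    suffices ∀ t : H ⊗[k] H, TensorProduct.map (antipode k) (antipode k)
        (TensorProduct.comm k H H t) * comul b =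
        Ψ (A.lTensor H (TensorProduct.assoc k H H H (t ⊗ₜ b))) by
      simpa [G] using this (comul a)
    intro t
    induction t with
    | zero => simp
    | add x y hx hy => simp only [add_mul, add_tmul, hx, hy, map_add]
    | tmul x y => simp [Ψ, A, ← mul_assoc]
  apply WithConv.ext
  ext h
  have e' := congrArg (fun φ => φ (comul h)) e
  simp only [LinearMap.comp_apply, LinearEquiv.coe_coe, coassoc_apply] at e'
  refine e'.trans ?_
  rw [← LinearMap.comp_apply (A.lTensor H), ← LinearMap.lTensor_comp, hA]
  have e2 : Ψ ∘ₗ (TensorProduct.mk k H H 1).lTensor H =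
      TensorProduct.mk k H H 1 ∘ₗ LinearMap.mul' k H ∘ₗ (antipode k).rTensor H := by
    ext; simp [Ψ]
  have e3 := congrArg (fun φ => φ (comul h)) e2
  simp only [LinearMap.comp_apply, mul_antipode_rTensor_comul_apply] at e3
  refine e3.trans ?_
  simp [LinearMap.convOne_def, Algebra.algebraMap_eq_smul_one, Algebra.TensorProduct.one_def]

/-- The form `(h, x) ↦ χ(S(h) x)` attached to a functional `χ` on `H`. -/
noncomputable def antipodeForm (χ : H →ₗ[k] k) : H →ₗ[k] H →ₗ[k] k :=
  (LinearMap.mul k H).compr₂ χ ∘ₗ antipode k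

@[simp]
theorem antipodeForm_apply (χ : H →ₗ[k] k) (h x : H) :
    antipodeForm χ h x = χ (antipode k h * x) := rfl

/-- For a right integral `χ`, `∑ χ(S(h) x₁) x₂ = ∑ h₁ χ(S(h₂) x)`. -/
theorem antipodeForm_comul {χ : H →ₗ[k] k} (hχ : IsRightIntegral χ) (h x : H) :
    TensorProduct.lid k H ((antipodeForm χ h).rTensor H (comul x)) =
      TensorProduct.rid k H (((antipodeForm χ).flip x).lTensor H (comul h)) := by
  -- `E (a ⊗ (b ⊗ c))` is `∑ a S(b) x₂ χ(S(c) x₁)`, evaluated on `h₁ ⊗ (h₂ ⊗ h₃)` in two ways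
  let D : H ⊗[k] H →ₗ[k] H := TensorProduct.lid k H ∘ₗ χ.rTensor H ∘ₗ
    LinearMap.mulRight k (comul (R := k) x) ∘ₗ TensorProduct.map (antipode k) (antipode k) ∘ₗ
    (TensorProduct.comm k H H).toLinearMap
  have hD (b : H) : D (comul b) = χ (antipode k b * x) • (1 : H) := by
    rw [← hχ, Bialgebra.comul_mul, comul_antipode]; rfl
  let E : H ⊗[k] (H ⊗[k] H) →ₗ[k] H := LinearMap.mul' k H ∘ₗ D.lTensor H
  have h1 : E (comul.lTensor H (comul h)) =
      TensorProduct.rid k H (((antipodeForm χ).flip x).lTensor H (comul h)) := by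
    suffices ∀ t : H ⊗[k] H, E (comul.lTensor H t) =
        TensorProduct.rid k H (((antipodeForm χ).flip x).lTensor H t) from this _
    intro t
    induction t with
    | zero => simp
    | add x y hx hy => simp only [map_add, hx, hy]
    | tmul a b => simp [E, hD]
  rw [← h1, ← coassoc_apply]
  let F : H ⊗[k] H →ₗ[k] H := LinearMap.mul' k H ∘ₗ LinearMap.lTensor H
    (TensorProduct.lid k H ∘ₗ χ.rTensor H ∘ₗ LinearMap.mulRight k (comul (R := k) x) ∘ₗ
      (TensorProduct.mk k H H).flip 1 ∘ₗ antipode k)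
  have h2 : E ∘ₗ (TensorProduct.assoc k H H H).toLinearMap =
      F ∘ₗ (LinearMap.mul' k H ∘ₗ (antipode k).lTensor H).rTensor H := by
    ext a b c
    suffices ∀ t : H ⊗[k] H,
      a * (TensorProduct.lid k H (χ.rTensor H ((antipode k c ⊗ₜ[k] antipode k b) * t))) =
      a * antipode k b * (TensorProduct.lid k H (χ.rTensor H ((antipode k c ⊗ₜ[k] 1) * t))) by
      simpa [E, D, F] using this (comul x)
    intro t
    induction t with
    | zero => simp
    | add x y hx hy => simp only [map_add, mul_add, hx, hy]
    | tmul p q => simp [mul_assoc]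
  have h3 := congrArg (fun φ => φ (comul.rTensor H (comul h))) h2
  simp only [LinearMap.comp_apply, LinearEquiv.coe_coe] at h3
  have h4 : (LinearMap.mul' k H ∘ₗ (antipode k).lTensor H).rTensor H
      (comul.rTensor H (comul h)) = (1 : H) ⊗ₜ[k] h := by
    rw [← LinearMap.comp_apply, ← LinearMap.rTensor_comp, LinearMap.comp_assoc,
      HopfAlgebra.mul_antipode_lTensor_comul, LinearMap.rTensor_comp, LinearMap.comp_apply,
      rTensor_counit_comul]
    simp
  rw [h3, h4]
  suffices ∀ t : H ⊗[k] H, TensorProduct.lid k H ((antipodeForm χ h).rTensor H t) =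
      TensorProduct.lid k H (χ.rTensor H ((antipode k h ⊗ₜ[k] 1) * t)) by
    simpa [F] using this (comul x)
  intro t
  induction t with
  | zero => simp
  | add x y hx hy => simp only [map_add, mul_add, hx, hy]
  | tmul p q => simp

/-- The left radical of `(h, x) ↦ χ(S(h) x)` is a left ideal and a left coideal, so that
`ε(c) 1 = ∑ S(c₁) c₂` lies in it whenever `c` does; it does not contain `1`, as `χ ≠ 0`. -/
theorem counit_eq_zero_of_antipodeForm_eq_zero {χ : H →ₗ[k] k} (hχ : IsRightIntegral χ)
    (h0 : χ ≠ 0) {c : H} (hc : antipodeForm χ c = 0) : counit (R := k) c = 0 := by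
  -- the radical is a left coideal: `∑ c₁ ⊗ χ(S(c₂) -) = 0`, checked on the coordinates of `c₁`
  have h1 : (antipodeForm χ).lTensor H (comul c) = 0 := by
    let b := Module.Free.chooseBasis k H
    apply (TensorProduct.equivFinsuppOfBasisLeft b).injective
    ext i x
    have h2 := antipodeForm_comul hχ c x
    rw [hc] at h2
    have h3 := congrArg (b.coord i) h2
    have h4 : ∀ t : H ⊗[k] H, b.coord i (TensorProduct.rid k H
        (((antipodeForm χ).flip x).lTensor H t)) =
        TensorProduct.equivFinsuppOfBasisLeft b ((antipodeForm χ).lTensor H t) i x := by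
      intro t
      induction t with
      | zero => simp
      | add x y hx hy => simp only [map_add, hx, hy, Finsupp.add_apply, LinearMap.add_apply]
      | tmul p q => simp [mul_comm]
    rw [← h4, ← h3]; simp
  by_contra hne
  apply h0
  ext x
  -- `ε(c) χ(x) = ∑ χ(S(S(c₁) c₂) x) = ∑ χ(S(c₂) S(S(c₁)) x)`
  have h5 : ∀ t : H ⊗[k] H, antipodeForm χ (LinearMap.mul' k H ((antipode k).rTensor H t)) x =
      TensorProduct.lift
        (LinearMap.id.flip ∘ₗ LinearMap.mulRight k x ∘ₗ antipode k ∘ₗ antipode k)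
        ((antipodeForm χ).lTensor H t) := by
    intro t
    induction t with
    | zero => simp
    | add x y hx hy => simp only [map_add, hx, hy, LinearMap.add_apply]
    | tmul p q => simp [antipode_mul_antidistrib, mul_assoc]
  have h6 := h5 (comul c)
  rw [h1, mul_antipode_rTensor_comul_apply, Algebra.algebraMap_eq_smul_one] at h6
  simpa [hne] using h6

/-- The counit lies in the closure of `{χ(S(-) e) | e ∈ H}`, for the topology of `H^*` in which
agreement on finite-dimensional subspaces of `H` defines the neighbourhoods. -/
theorem exists_forall_antipodeForm_eq_counit {χ : H →ₗ[k] k} (hχ : IsRightIntegral χ)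
    (h0 : χ ≠ 0) (C : Submodule k H) [FiniteDimensional k C] :
    ∃ e : H, ∀ c ∈ C, antipodeForm χ c e = counit (R := k) c := by
  let B : C →ₗ[k] Module.Dual k H := antipodeForm χ ∘ₗ C.subtype
  have h1 : counit ∘ₗ C.subtype ∈
      (LinearMap.range B.flip).dualCoannihilator.dualAnnihilator := by
    rw [Submodule.mem_dualAnnihilator]
    intro c hc
    rw [LinearMap.dualCoannihilator_range_eq_ker_flip, LinearMap.flip_flip,
      LinearMap.mem_ker] at hc
    exact counit_eq_zero_of_antipodeForm_eq_zero hχ h0 hc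
  rw [Subspace.dualCoannihilator_dualAnnihilator_eq] at h1
  obtain ⟨e, he⟩ := h1
  exact ⟨e, fun c hc => LinearMap.congr_fun he ⟨c, hc⟩⟩

/-- Writing `α(h) = χ(S(h) -)`, every finite subset of `H` has a common local unit `e`, in the sense
that `h = ∑ α(h)(e₁) e₂` for all its elements `h`. It suffices that `χ(S(-) e)` agrees with the
counit on the right tensor factors of `Δ(h)`. -/
theorem exists_forall_mem_antipodeForm_comul_eq {χ : H →ₗ[k] k} (hχ : IsRightIntegral χ)
    (h0 : χ ≠ 0) (s : Finset H) :
    ∃ e : H, ∀ h ∈ s, TensorProduct.lid k H ((antipodeForm χ h).rTensor H (comul e)) = h := by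
  classical
  let C : Submodule k H := Submodule.span k
    (s.biUnion fun h => (ℛ k h).index.image (ℛ k h).right : Finset H)
  obtain ⟨e, he⟩ := exists_forall_antipodeForm_eq_counit hχ h0 C
  refine ⟨e, fun h hs => ?_⟩
  rw [antipodeForm_comul hχ, ← (ℛ k h).eq]
  have h2 := congrArg (TensorProduct.rid k H) (sum_tmul_counit_eq (ℛ k h))
  simp only [map_sum, rid_tmul, one_smul] at h2
  refine Eq.trans ?_ h2
  simp only [map_sum, LinearMap.lTensor_tmul, rid_tmul]
  refine Finset.sum_congr rfl fun i hi => ?_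
  rw [LinearMap.flip_apply, he]
  exact Submodule.subset_span
    (Finset.mem_coe.2 (Finset.mem_biUnion.2 ⟨h, hs, Finset.mem_image_of_mem _ hi⟩))

end HopfAlgebra

/-! ### The functor `H ⊗_{H^*} -` and its right adjoint -/

namespace Comod

section Coalg

variable {k : Type u} {H : Type v} [Field k] [AddCommGroup H] [Module k H] [Coalgebra k H]

/-- The right action of `H^*` on `H`: `h ↦ ∑ ξ(h₁) h₂`. -/
noncomputable def dualAct (ξ : WithConv (H →ₗ[k] k)) : H →ₗ[k] H :=
  convAct ξ.ofConv LinearMap.id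

theorem dualAct_apply (ξ : WithConv (H →ₗ[k] k)) (h : H) :
    dualAct ξ h = TensorProduct.lid k H (ξ.ofConv.rTensor H (Coalgebra.comul h)) := rfl

theorem comp_dualAct {X : Type v} [AddCommGroup X] [Module k X] (ξ : WithConv (H →ₗ[k] k))
    (f : H →ₗ[k] X) : f ∘ₗ dualAct ξ = convAct ξ.ofConv f :=
  convAct_comp ξ.ofConv LinearMap.id f

/-- The right action of `H^*` on `H` commutes with the right coaction of `H` on itself. -/
theorem comul_comp_dualAct (ξ : WithConv (H →ₗ[k] k)) :
    Coalgebra.comul ∘ₗ dualAct ξ = (dualAct ξ).rTensor H ∘ₗ Coalgebra.comul (R := k) :=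
  convAct_mem_colinear (X := regular k H) ξ.ofConv (id_mem_colinear _)

/-- The action of `k ⊆ H^*` on `Hom^H(H, X)` is the scalar multiplication of linear maps. -/
instance (X : Comod k H) :
    IsScalarTower k (WithConv (H →ₗ[k] k)) (colinear (regular k H) X) :=
  .of_algebraMap_smul fun c f => by
    rw [Algebra.algebraMap_eq_smul_one]
    refine Subtype.ext ?_
    change convAct (H := H) (c • (1 : WithConv (H →ₗ[k] k))).ofConv f.1 = c • f.1
    conv_rhs => rw [← convAct_one f.1]
    ext h
    simp [convAct, TensorProduct.map_smul_left]

theorem coe_comp_dualAct {M : Type v} [AddCommGroup M] [Module (WithConv (H →ₗ[k] k)) M]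
    {X : Comod k H} (φ : M →ₗ[WithConv (H →ₗ[k] k)] colinear (regular k H) X)
    (ξ : WithConv (H →ₗ[k] k)) (m : M) : (φ m).1 ∘ₗ dualAct ξ = (φ (ξ • m)).1 := by
  rw [map_smul]
  exact comp_dualAct ξ (φ m).1

section Tensor

variable (k H)
variable (M N : Type v) [AddCommGroup M] [Module k M] [Module (WithConv (H →ₗ[k] k)) M]
  [AddCommGroup N] [Module k N] [Module (WithConv (H →ₗ[k] k)) N]

/-- The subspace of `H ⊗ M` spanned by the elements `h · ξ ⊗ m - h ⊗ ξ m`. -/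
noncomputable def balancedRel : Submodule k (H ⊗[k] M) :=
  Submodule.span k (Set.range fun p : WithConv (H →ₗ[k] k) × H × M =>
    dualAct p.1 p.2.1 ⊗ₜ[k] p.2.2 - p.2.1 ⊗ₜ[k] (p.1 • p.2.2))

/-- The tensor product `H ⊗_{H^*} M` over the non-commutative ring `H^*`, as a quotient of the tensor
product over `k`. -/
abbrev DualTensor : Type v := (H ⊗[k] M) ⧸ balancedRel k H M

namespace DualTensor

/-- The map `m ↦ (h ↦ h ⊗ m)`, with values in `H ⊗_{H^*} M`. -/
noncomputable def mk : M →ₗ[k] H →ₗ[k] DualTensor k H M :=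
  ((TensorProduct.mk k H M).compr₂ (balancedRel k H M).mkQ).flip

variable {k H M N}

theorem mk_dualAct (ξ : WithConv (H →ₗ[k] k)) (h : H) (m : M) :
    mk k H M m (dualAct ξ h) = mk k H M (ξ • m) h := by
  have := (Submodule.Quotient.mk_eq_zero (balancedRel k H M)).2
    (Submodule.subset_span ⟨(ξ, h, m), rfl⟩)
  rwa [Submodule.Quotient.mk_sub, sub_eq_zero] at this

theorem hom_ext {P : Type*} [AddCommGroup P] [Module k P] {f g : DualTensor k H M →ₗ[k] P}
    (h : ∀ m, f ∘ₗ mk k H M m = g ∘ₗ mk k H M m) : f = g := by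
  apply Submodule.linearMap_qext
  ext x m
  exact LinearMap.congr_fun (h m) x

/-- The universal property of `H ⊗_{H^*} M`: the linear map `h ⊗ m ↦ f m h` induced by a balanced
bilinear map. -/
noncomputable def lift {P : Type*} [AddCommGroup P] [Module k P] (f : M →ₗ[k] H →ₗ[k] P)
    (hf : ∀ (ξ : WithConv (H →ₗ[k] k)) m, f m ∘ₗ dualAct ξ = f (ξ • m)) :
    DualTensor k H M →ₗ[k] P :=
  (balancedRel k H M).liftQ (TensorProduct.lift f.flip) <| by
    rw [balancedRel, Submodule.span_le]
    rintro _ ⟨⟨ξ, h, m⟩, rfl⟩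
    simpa [sub_eq_zero] using LinearMap.congr_fun (hf ξ m) h

@[simp]
theorem lift_comp_mk {P : Type*} [AddCommGroup P] [Module k P] (f : M →ₗ[k] H →ₗ[k] P)
    (hf : ∀ (ξ : WithConv (H →ₗ[k] k)) m, f m ∘ₗ dualAct ξ = f (ξ • m)) (m : M) :
    lift f hf ∘ₗ mk k H M m = f m := by
  ext h; simp [lift, mk]

variable (k H M) in
/-- The coaction `h ⊗ m ↦ ∑ (h₁ ⊗ m) ⊗ h₂` on `H ⊗_{H^*} M`. -/
noncomputable def coact : DualTensor k H M →ₗ[k] DualTensor k H M ⊗[k] H :=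
  lift (LinearMap.lcomp k _ (Coalgebra.comul (R := k) (A := H)) ∘ₗ
    LinearMap.rTensorHom H ∘ₗ mk k H M) fun ξ m => by
    change ((mk k H M m).rTensor H ∘ₗ Coalgebra.comul) ∘ₗ dualAct ξ =
      (mk k H M (ξ • m)).rTensor H ∘ₗ Coalgebra.comul
    rw [LinearMap.comp_assoc, comul_comp_dualAct, ← LinearMap.comp_assoc,
      ← LinearMap.rTensor_comp]
    congr 2
    ext h
    exact mk_dualAct ξ h m

theorem coact_comp_mk (m : M) :
    coact k H M ∘ₗ mk k H M m = (mk k H M m).rTensor H ∘ₗ Coalgebra.comul :=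
  lift_comp_mk _ _ m

theorem coassoc :
    (TensorProduct.assoc k (DualTensor k H M) H H).toLinearMap ∘ₗ
      (coact k H M).rTensor H ∘ₗ coact k H M =
    (Coalgebra.comul (R := k) (A := H)).lTensor (DualTensor k H M) ∘ₗ coact k H M := by
  refine hom_ext fun m => ?_
  have e : (TensorProduct.assoc k (DualTensor k H M) H H).toLinearMap ∘ₗ
      ((mk k H M m).rTensor H).rTensor H =
      (mk k H M m).rTensor (H ⊗[k] H) ∘ₗ (TensorProduct.assoc k H H H).toLinearMap := by
    ext; simp
  have e' : (Coalgebra.comul (R := k) (A := H)).lTensor (DualTensor k H M) ∘ₗ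
      (mk k H M m).rTensor H = (mk k H M m).rTensor (H ⊗[k] H) ∘ₗ
        (Coalgebra.comul (R := k) (A := H)).lTensor H := by
    ext; simp
  calc _ = (TensorProduct.assoc k (DualTensor k H M) H H).toLinearMap ∘ₗ
        (coact k H M ∘ₗ mk k H M m).rTensor H ∘ₗ Coalgebra.comul := by
        rw [LinearMap.rTensor_comp, LinearMap.comp_assoc, LinearMap.comp_assoc, coact_comp_mk]
        rfl
    _ = (mk k H M m).rTensor (H ⊗[k] H) ∘ₗ (TensorProduct.assoc k H H H).toLinearMap ∘ₗ
        Coalgebra.comul.rTensor H ∘ₗ Coalgebra.comul := by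
        rw [coact_comp_mk, LinearMap.rTensor_comp]
        simp only [← LinearMap.comp_assoc, e]
    _ = _ := by
        rw [Coalgebra.coassoc, LinearMap.comp_assoc, coact_comp_mk, ← LinearMap.comp_assoc,
          ← LinearMap.comp_assoc, e']

theorem lTensor_counit_comp_coact :
    (Coalgebra.counit (R := k) (A := H)).lTensor (DualTensor k H M) ∘ₗ coact k H M =
      (TensorProduct.mk k (DualTensor k H M) k).flip 1 := by
  refine hom_ext fun m => ?_
  have e : (Coalgebra.counit (R := k) (A := H)).lTensor (DualTensor k H M) ∘ₗ
      (mk k H M m).rTensor H = (mk k H M m).rTensor k ∘ₗ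
        (Coalgebra.counit (R := k) (A := H)).lTensor H := by
    ext; simp
  rw [LinearMap.comp_assoc, coact_comp_mk, ← LinearMap.comp_assoc, e, LinearMap.comp_assoc,
    Coalgebra.lTensor_counit_comp_comul]
  ext; simp

variable (k H M) in
/-- `H ⊗_{H^*} M` as a right `H`-comodule. -/
noncomputable abbrev comod : Comod k H where
  carrier := DualTensor k H M
  coact := coact k H M
  coassoc := coassoc
  lTensor_counit_comp_coact := lTensor_counit_comp_coact

theorem mk_mem_colinear (m : M) : mk k H M m ∈ colinear (regular k H) (comod k H M) :=
  coact_comp_mk m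

theorem mem_colinear_iff {X : Comod k H} {g : DualTensor k H M →ₗ[k] X.carrier} :
    g ∈ colinear (comod k H M) X ↔ ∀ m, g ∘ₗ mk k H M m ∈ colinear (regular k H) X := by
  refine ⟨fun hg m => comp_mem_colinear (mk_mem_colinear m) hg, fun hg => ?_⟩
  refine hom_ext fun m => ?_
  have := hg m
  rw [mem_colinear] at this
  rw [LinearMap.comp_assoc, this, LinearMap.comp_assoc]
  change _ = g.rTensor H ∘ₗ coact k H M ∘ₗ mk k H M m
  rw [coact_comp_mk, ← LinearMap.comp_assoc, ← LinearMap.rTensor_comp]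

variable [IsScalarTower k (WithConv (H →ₗ[k] k)) M] [IsScalarTower k (WithConv (H →ₗ[k] k)) N]

/-- The map `h ⊗ m ↦ h ⊗ g m` induced by an `H^*`-linear map `g`. -/
noncomputable def map (g : M →ₗ[WithConv (H →ₗ[k] k)] N) :
    DualTensor k H M →ₗ[k] DualTensor k H N :=
  lift (mk k H N ∘ₗ g.restrictScalars k) fun ξ m => by
    ext h; simp [mk_dualAct]

@[simp]
theorem map_comp_mk (g : M →ₗ[WithConv (H →ₗ[k] k)] N) (m : M) :
    map g ∘ₗ mk k H M m = mk k H N (g m) :=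
  lift_comp_mk _ _ m

theorem map_mem_colinear (g : M →ₗ[WithConv (H →ₗ[k] k)] N) :
    map g ∈ colinear (comod k H M) (comod k H N) :=
  mem_colinear_iff.2 fun m => by rw [map_comp_mk]; exact mk_mem_colinear _

/-- The linear map `h ⊗ m ↦ φ(m)(h)` on `H ⊗_{H^*} M` induced by `φ : M → Hom^H(H, X)`. -/
noncomputable def liftColinear {X : Comod k H}
    (φ : M →ₗ[WithConv (H →ₗ[k] k)] colinear (regular k H) X) :
    DualTensor k H M →ₗ[k] X.carrier :=
  lift ((colinear (regular k H) X).subtype ∘ₗ φ.restrictScalars k) (coe_comp_dualAct φ)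

theorem liftColinear_comp_mk {X : Comod k H}
    (φ : M →ₗ[WithConv (H →ₗ[k] k)] colinear (regular k H) X) (m : M) :
    liftColinear φ ∘ₗ mk k H M m = (φ m).1 :=
  lift_comp_mk _ (coe_comp_dualAct φ) m

variable (M) in
/-- The tensor-hom correspondence `Hom^H(H ⊗_{H^*} M, X) ≃ Hom_{H^*}(M, Hom^H(H, X))`. -/
noncomputable def homEquiv (X : Comod k H) : colinear (comod k H M) X ≃
    (M →ₗ[WithConv (H →ₗ[k] k)] colinear (regular k H) X) where
  toFun g :=
    { toFun m := ⟨g.1 ∘ₗ mk k H M m, mem_colinear_iff.1 g.2 m⟩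
      map_add' m m' := Subtype.ext (by simp [LinearMap.comp_add])
      map_smul' ξ m := Subtype.ext (by
        change g.1 ∘ₗ mk k H M (ξ • m) = convAct (H := H) ξ.ofConv (g.1 ∘ₗ mk k H M m)
        rw [← comp_dualAct]
        ext h
        exact congrArg g.1 (mk_dualAct ξ h m).symm) }
  invFun φ := ⟨liftColinear φ, mem_colinear_iff.2 fun m => by
    rw [liftColinear_comp_mk]; exact (φ m).2⟩
  left_inv _ := Subtype.ext (hom_ext fun m => liftColinear_comp_mk _ m)
  right_inv φ := LinearMap.ext fun m => Subtype.ext (liftColinear_comp_mk φ m)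

end DualTensor

end Tensor

open scoped ModuleCat

variable (k H) in
/-- The functor `H ⊗_{H^*} -` from left `H^*`-modules to right `H`-comodules. The `k`-structure on an
`H^*`-module is the one obtained by restriction along `k → H^*`. -/
noncomputable def tensorFunctor : ModuleCat.{v} (WithConv (H →ₗ[k] k)) ⥤ Comod k H where
  obj M := DualTensor.comod k H M
  map g := ⟨DualTensor.map g.hom, DualTensor.map_mem_colinear g.hom⟩
  map_id M := Subtype.ext (DualTensor.hom_ext fun m => DualTensor.map_comp_mk _ m)
  map_comp f g := Subtype.ext (DualTensor.hom_ext fun m => by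
    refine (DualTensor.map_comp_mk (f ≫ g).hom m).trans ?_
    change _ = (DualTensor.map g.hom ∘ₗ DualTensor.map f.hom) ∘ₗ _
    rw [LinearMap.comp_assoc, DualTensor.map_comp_mk, DualTensor.map_comp_mk]
    rfl)

variable (k H) in
/-- `H ⊗_{H^*} -` is left adjoint to `Hom^H(H, -)`. -/
noncomputable def tensorHomAdjunction : tensorFunctor k H ⊣ homFunctor k H :=
  Adjunction.mkOfHomEquiv
    { homEquiv M X := (DualTensor.homEquiv M X).trans
        (ModuleCat.homEquiv (M := M) (N := (homFunctor k H).obj X)).symm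
      homEquiv_naturality_left_symm := fun {M M' X} f g =>
        Subtype.ext (DualTensor.hom_ext fun m => by
          refine (DualTensor.liftColinear_comp_mk (f ≫ g).hom m).trans ?_
          change _ = (DualTensor.liftColinear g.hom ∘ₗ DualTensor.map f.hom) ∘ₗ _
          rw [LinearMap.comp_assoc, DualTensor.map_comp_mk]
          exact (DualTensor.liftColinear_comp_mk g.hom (f.hom m)).symm)
      homEquiv_naturality_right := fun {M X Y} f g =>
        ModuleCat.hom_ext (LinearMap.ext fun m => Subtype.ext rfl) }

end Coalg

end Comod

/-! ### Kernels in the category of comodules -/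

namespace Comod

section Coalg

variable {k : Type u} {H : Type v} [Field k] [AddCommGroup H] [Module k H] [Coalgebra k H]

instance : Preadditive (Comod k H) where
  homGroup M N := inferInstanceAs (AddCommGroup (colinear M N))
  add_comp _ _ _ f f' g := Subtype.ext (LinearMap.comp_add f.1 f'.1 g.1)
  comp_add _ _ _ f g g' := Subtype.ext (LinearMap.add_comp f.1 g'.1 g.1)

instance : Limits.HasZeroObject (Comod k H) where
  zero :=
    let Z : Comod k H :=
      { carrier := PUnit
        coact := 0
        coassoc := by simp
        lTensor_counit_comp_coact := LinearMap.ext fun x => by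
          rw [Subsingleton.elim x 0, map_zero, map_zero] }
    ⟨Z, (Limits.IsZero.iff_id_eq_zero Z).2 (Subtype.ext (LinearMap.ext fun _ => rfl))⟩

/-- A colinear injection `i` with `f ∘ i = 0` whose image contains the kernel of `f` is a kernel
of `f` in the category of comodules. -/
noncomputable def isLimitOfInjective {X Y Z : Comod k H} (f : Y ⟶ Z) (i : X ⟶ Y) (w : i ≫ f = 0)
    (hi : Function.Injective i.1) (hr : LinearMap.ker f.1 ≤ LinearMap.range i.1) :
    Limits.IsLimit (Limits.KernelFork.ofι i w) :=
  have hg {W : Comod k H} (g : W ⟶ Y) (hg : g ≫ f = 0) :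
      ∃ g' : W ⟶ X, g' ≫ i = g := by
    obtain ⟨φ, hφ⟩ : ∃ φ : W.carrier →ₗ[k] X.carrier, i.1 ∘ₗ φ = g.1 := by
      let φ' := g.1.codRestrict (LinearMap.range i.1) fun x =>
        hr (LinearMap.congr_fun (congrArg Subtype.val hg) x)
      refine ⟨(LinearEquiv.ofInjective i.1 hi).symm.toLinearMap ∘ₗ φ', LinearMap.ext fun x => ?_⟩
      exact congrArg Subtype.val ((LinearEquiv.ofInjective i.1 hi).apply_symm_apply (φ' x))
    refine ⟨⟨φ, ?_⟩, Subtype.ext hφ⟩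
    -- `i ⊗ id` is injective because `H` is flat over the field `k`
    have hinj : Function.Injective (i.1.rTensor H) :=
      Module.Flat.rTensor_preserves_injective_linearMap i.1 hi
    refine LinearMap.ext fun x => hinj ?_
    refine LinearMap.congr_fun (f := i.1.rTensor H ∘ₗ (X.coact ∘ₗ φ))
      (g := i.1.rTensor H ∘ₗ (φ.rTensor H ∘ₗ W.coact)) ?_ x
    rw [← LinearMap.comp_assoc, ← LinearMap.comp_assoc, ← LinearMap.rTensor_comp, hφ,
      ← mem_colinear.1 i.2, LinearMap.comp_assoc, hφ, mem_colinear.1 g.2]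
  Limits.KernelFork.IsLimit.ofι i w (fun g h => (hg g h).choose) (fun g h => (hg g h).choose_spec)
    fun g h m hm => Subtype.ext <| LinearMap.ext fun x => hi <| by
      exact LinearMap.congr_fun (congrArg Subtype.val (hm.trans (hg g h).choose_spec.symm)) x

open scoped ModuleCat in
instance : (tensorFunctor k H).Additive where
  map_add {M N f g} := Subtype.ext <| DualTensor.hom_ext fun m => by
    refine (DualTensor.map_comp_mk (f + g).hom m).trans ?_
    change _ = (DualTensor.map f.hom + DualTensor.map g.hom) ∘ₗ _
    rw [LinearMap.add_comp, DualTensor.map_comp_mk, DualTensor.map_comp_mk, ← map_add]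
    rfl

end Coalg

/-! ### Flatness of `H` over `H^*` in the presence of an integral -/

namespace DualTensor

open WithConv HopfAlgebra

variable {k : Type u} {H : Type v} [Field k] [Ring H] [HopfAlgebra k H] {χ : H →ₗ[k] k}

/-- The map `h ↦ χ(S(h) -)` from `H` to `H^*` is right `H^*`-linear. -/
theorem antipodeForm_dualAct (hχ : IsRightIntegral χ) (ξ : WithConv (H →ₗ[k] k)) (h : H) :
    toConv (antipodeForm χ (dualAct ξ h)) = toConv (antipodeForm χ h) * ξ := by
  ext x
  have h1 := congrArg ξ.ofConv (antipodeForm_comul hχ h x)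
  have h2 : ∀ t : H ⊗[k] H, ξ.ofConv (TensorProduct.rid k H
      (((antipodeForm χ).flip x).lTensor H t)) =
      antipodeForm χ (TensorProduct.lid k H (ξ.ofConv.rTensor H t)) x := by
    intro t
    induction t with
    | zero => simp
    | add x y hx hy => simp only [map_add, hx, hy, LinearMap.add_apply]
    | tmul p q => simp [mul_comm]
  have h3 : ∀ t : H ⊗[k] H, ξ.ofConv (TensorProduct.lid k H ((antipodeForm χ h).rTensor H t)) =
      LinearMap.mul' k k (TensorProduct.map (antipodeForm χ h) ξ.ofConv t) := by
    intro t
    induction t with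
    | zero => simp
    | add x y hx hy => simp only [map_add, hx, hy]
    | tmul p q => simp
  rw [h2, h3] at h1
  exact h1.symm

variable {M N : Type v} [AddCommGroup M] [Module k M] [Module (WithConv (H →ₗ[k] k)) M]
  [AddCommGroup N] [Module k N] [Module (WithConv (H →ₗ[k] k)) N]
  [IsScalarTower k (WithConv (H →ₗ[k] k)) M] [IsScalarTower k (WithConv (H →ₗ[k] k)) N]

variable (M) in
/-- The natural map `H ⊗_{H^*} M → M`, `h ⊗ m ↦ χ(S(h) -) m`, attached to a right integral `χ`. It is
only `k`-linear: it need not respect the left `H^*`-action `ξ (h ⊗ m) = ∑ h₁ ξ(h₂) ⊗ m` defined by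
the coaction. -/
noncomputable def toModule (hχ : IsRightIntegral χ) : DualTensor k H M →ₗ[k] M :=
  lift
    (LinearMap.flip ((Algebra.lsmul k k M).toLinearMap ∘ₗ
      (WithConv.linearEquiv k (H →ₗ[k] k)).symm.toLinearMap ∘ₗ antipodeForm χ))
    fun ξ m => by
      ext h
      change toConv (antipodeForm χ (dualAct ξ h)) • m = toConv (antipodeForm χ h) • ξ • m
      rw [antipodeForm_dualAct hχ, mul_smul]

theorem toModule_mk (hχ : IsRightIntegral χ) (m : M) (h : H) :
    toModule M hχ (mk k H M m h) = toConv (antipodeForm χ h) • m :=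
  rfl

theorem toModule_map (hχ : IsRightIntegral χ) (g : M →ₗ[WithConv (H →ₗ[k] k)] N)
    (t : DualTensor k H M) : toModule N hχ (map g t) = g (toModule M hχ t) := by
  refine LinearMap.congr_fun (f := toModule N hχ ∘ₗ map g)
    (g := g.restrictScalars k ∘ₗ toModule M hχ) (hom_ext fun m => ?_) t
  rw [LinearMap.comp_assoc, map_comp_mk]
  ext h
  simp [toModule_mk]

/-- With a common local unit `e` for the `hᵢ`, an element `t = ∑ hᵢ ⊗ mᵢ` equals
`∑ e · α(hᵢ) ⊗ mᵢ = e ⊗ ∑ α(hᵢ) mᵢ`, where `α(h) = χ(S(h) -)`. -/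
theorem exists_eq_mk_toModule (hχ : IsRightIntegral χ) (h0 : χ ≠ 0) (t : DualTensor k H M) :
    ∃ e : H, t = mk k H M (toModule M hχ t) e := by
  classical
  obtain ⟨t, rfl⟩ := Submodule.Quotient.mk_surjective _ t
  obtain ⟨s, rfl⟩ := TensorProduct.exists_finset t
  obtain ⟨e, he⟩ := exists_forall_mem_antipodeForm_comul_eq hχ h0 (s.image Prod.fst)
  refine ⟨e, ?_⟩
  have hs : Submodule.Quotient.mk (p := balancedRel k H M) (∑ i ∈ s, i.1 ⊗ₜ[k] i.2) =
      ∑ i ∈ s, mk k H M i.2 i.1 := map_sum (balancedRel k H M).mkQ _ _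
  rw [hs, map_sum, map_sum, LinearMap.sum_apply]
  refine Finset.sum_congr rfl fun i hi => ?_
  rw [toModule_mk, ← mk_dualAct]
  exact congrArg _ (he i.1 (Finset.mem_image_of_mem _ hi)).symm

theorem toModule_injective (hχ : IsRightIntegral χ) (h0 : χ ≠ 0) :
    Function.Injective (toModule M hχ) := by
  rw [injective_iff_map_eq_zero]
  intro t ht
  obtain ⟨e, he⟩ := exists_eq_mk_toModule hχ h0 t
  rw [he, ht, map_zero, LinearMap.zero_apply]

theorem map_injective (hχ : IsRightIntegral χ) (h0 : χ ≠ 0)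
    {g : M →ₗ[WithConv (H →ₗ[k] k)] N} (hg : Function.Injective g) :
    Function.Injective (map g) := by
  refine Function.Injective.of_comp (f := toModule N hχ) ?_
  have : toModule N hχ ∘ map g = g ∘ toModule M hχ := funext (toModule_map hχ g)
  rw [this]
  exact hg.comp (toModule_injective hχ h0)

variable {L : Type v} [AddCommGroup L] [Module k L] [Module (WithConv (H →ₗ[k] k)) L]
  [IsScalarTower k (WithConv (H →ₗ[k] k)) L]

/-- If `t = e ⊗ m` is in the kernel, with `m` the image of `t` in `M`, then `g m = 0`, so `m` lifts
to `L`. -/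
theorem ker_map_le_range_map (hχ : IsRightIntegral χ) (h0 : χ ≠ 0)
    {f : L →ₗ[WithConv (H →ₗ[k] k)] M} {g : M →ₗ[WithConv (H →ₗ[k] k)] N}
    (hfg : Function.Exact f g) : LinearMap.ker (map g) ≤ LinearMap.range (map f) := by
  intro t ht
  obtain ⟨e, he⟩ := exists_eq_mk_toModule hχ h0 t
  obtain ⟨l, hl⟩ := (hfg (toModule M hχ t)).1 (by
    rw [← toModule_map, LinearMap.mem_ker.1 ht, map_zero])
  refine ⟨mk k H L l e, ?_⟩
  rw [he, ← hl]
  exact LinearMap.congr_fun (map_comp_mk f l) e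

end DualTensor

open scoped ModuleCat in
theorem tensorFunctor_preservesFiniteLimits {k : Type u} {H : Type v} [Field k] [Ring H]
    [HopfAlgebra k H] {χ : H →ₗ[k] k} (hχ : IsRightIntegral χ) (h0 : χ ≠ 0) :
    Limits.PreservesFiniteLimits (tensorFunctor k H) := by
  have : ∀ {M N : ModuleCat.{v} (WithConv (H →ₗ[k] k))} (f : M ⟶ N),
      Limits.PreservesLimit (Limits.parallelPair f 0) (tensorFunctor k H) := fun f =>
    Limits.preservesLimit_of_preserves_limit_cone (ModuleCat.kernelIsLimit f) <|
      (Limits.KernelFork.isLimitMapConeEquiv _ _).symm <|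
        isLimitOfInjective _ _
          (by rw [← Functor.map_comp, Limits.KernelFork.condition, Functor.map_zero])
          (DualTensor.map_injective hχ h0 (g := (LinearMap.ker f.hom).subtype)
            Subtype.val_injective)
          (DualTensor.ker_map_le_range_map hχ h0 (f := (LinearMap.ker f.hom).subtype)
            (g := f.hom) (LinearMap.exact_subtype_ker_map f.hom))
  exact Functor.preservesFiniteLimits_of_preservesKernels _

end Comod

theorem mainTheorem4 (k : Type u) (H : Type v) [Field k] [Ring H] [HopfAlgebra k H]
    (hH : ∃ χ : H →ₗ[k] k, χ ≠ 0 ∧ IsRightIntegral χ) :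
    ∃ U : ModuleCat.{v} (WithConv (H →ₗ[k] k)) ⥤ Comod k H,
      Nonempty (U ⊣ Comod.homFunctor k H) ∧
      Limits.PreservesFiniteLimits U ∧ Limits.PreservesFiniteColimits U := by
  obtain ⟨χ, h0, hχ⟩ := hH
  have adj := Comod.tensorHomAdjunction k H
  have := adj.leftAdjoint_preservesColimits
  exact ⟨Comod.tensorFunctor k H, ⟨adj⟩, Comod.tensorFunctor_preservesFiniteLimits hχ h0,
    inferInstance⟩
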